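/- There are universal constants $C_3, C_5 > 0$ such that the following holds. Let $t_{\max},\omega_{\max}>0$, $T=[-t_{\max},t_{\max}]$, $\Omega=[-\omega_{\max},\omega_{\max}]$, with lengths $|T|=2t_{\max}$ and $|\Omega|=2\omega_{\max}$. Let $A\in\mathbb{C}\setminus\{0\}$, $\omega_0\in\Omega$, $\sigma_n\ge 0$, $\delta>0$, and let $m$ be a natural number. Let $t_1,\dots,t_m$ be independent random variables, uniformly distributed on $T$, and let $n_1,\dots,n_m$ be independent zero-mean complex Gaussian random variables with variance $\sigma_n^2$ (that is, the real and imaginary parts of each $n_k$ are independent real zero-mean Gaussians with variance $\sigma_n^2/2$), the noise $(n_k)_k$ being independent of the times $(t_k)_k$. For $\omega\in\mathbb{R}$ put \[ X(\omega)=\sum_{k=1}^m A e^{\mathrm{i}\omega_0 t_k}\,\overline{e^{\mathrm{i}\omega t_k}},\qquad N(\omega)=\sum_{k=1}^m n_k\,\overline{e^{\mathrm{i}\omega t_k}},\qquad \widetilde R_{\widehat s\widehat s,n}(\omega)=\frac{2\pi|T|}{m}\bigl(X(\omega)+N(\omega)\bigr). \] Suppose that $|\Omega||T|\ge 3$, that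 $m\ge C_3\log(1/\delta)$, and that \[ m\ge C_5\cdot\max\left(\frac{\log(12|\Omega||T|/\delta)}{(1-0.218)^2},\ \frac{\sqrt{\log(4/\delta)\log(12|\Omega||T|/\delta)}}{1-0.218},\ \frac{\max\left(\log(|\Omega||T|),\log(2/\delta)\right)}{(1-0.218)^2}\cdot\frac{\sigma_n^2}{|A|^2}\right). \] Then with probability at least $1-2\delta$, the maximum of $|\widetilde R_{\widehat s\widehat s,n}(\omega)|$ over $\omega\in\Omega$ is attained, and every point $\widehat\omega_0\in\Omega$ at which it is attained lies in the interval $[\omega_0-2\pi|T|^{-1},\ \omega_0+2\pi|T|^{-1}]$. -/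

import Mathlib

open MeasureTheory ProbabilityTheory
open scoped NNReal ENNReal ComplexConjugate

namespace ToneEstimation

/-- The inner product `⟨y, ψ⟩ = ∑ₖ y[k] * conj ψ[k]` on `ℂᵐ`, linear in the first argument. -/
noncomputable def innerProd {m : ℕ} (y ψ : Fin m → ℂ) : ℂ :=
  ∑ k, y k * conj (ψ k)

/-- The test vector `ψ_ω[k] = exp (i ω t_k)` for the sampling times `t`. -/
noncomputable def testVector {m : ℕ} (t : Fin m → ℝ) (ω : ℝ) : Fin m → ℂ :=
  fun k => Complex.exp (Complex.I * (ω * t k : ℝ))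

/-- The noiseless observations `y[k] = A exp (i ω₀ t_k)`. -/
noncomputable def observations {m : ℕ} (A : ℂ) (ω₀ : ℝ) (t : Fin m → ℝ) : Fin m → ℂ :=
  fun k => A * Complex.exp (Complex.I * (ω₀ * t k : ℝ))

/-- The signal process `X(ω) = ⟨y, ψ_ω⟩`. -/
noncomputable def signalProcess {m : ℕ} (A : ℂ) (ω₀ : ℝ) (t : Fin m → ℝ) (ω : ℝ) : ℂ :=
  innerProd (observations A ω₀ t) (testVector t ω)

/-- The noise process `N(ω) = ⟨n, ψ_ω⟩`. -/
noncomputable def noiseProcess {m : ℕ} (t : Fin m → ℝ) (n : Fin m → ℂ) (ω : ℝ) : ℂ :=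
  innerProd n (testVector t ω)

/-- The estimate of the autocorrelation function from noisy samples,
`(2π|T| / m) (X(ω) + N(ω))`, where `T = [-tmax, tmax]` has length `|T| = 2 tmax`. -/
noncomputable def noisyEstimate {m : ℕ} (tmax : ℝ) (A : ℂ) (ω₀ : ℝ)
    (t : Fin m → ℝ) (n : Fin m → ℂ) (ω : ℝ) : ℂ :=
  ((2 * Real.pi * (2 * tmax) / m : ℝ) : ℂ) * (signalProcess A ω₀ t ω + noiseProcess t n ω)

/-- `Z` is a zero-mean complex Gaussian random variable with variance `v`: its real and
imaginary parts are independent real centred Gaussian variables with variance `v / 2`.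
(For `v = 0` this means `Z = 0` almost surely.) -/
structure IsComplexGaussian {S : Type*} [MeasurableSpace S] (Z : S → ℂ) (v : ℝ≥0)
    (P : Measure S) : Prop where
  law_re : HasLaw (fun x => (Z x).re) (gaussianReal 0 (v / 2)) P
  law_im : HasLaw (fun x => (Z x).im) (gaussianReal 0 (v / 2)) P
  indep : IndepFun (fun x => (Z x).re) (fun x => (Z x).im) P

/-- The sampling times `t₁, …, t_m` are independent and uniform on `T = [-tmax, tmax]`; the
noise terms `n₁, …, n_m` are independent zero-mean complex Gaussians of variance `σ²`; and
the noise vector is independent of the sampling times. -/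
structure IsSamplingModel {S : Type*} [MeasurableSpace S] (P : Measure S) {m : ℕ}
    (tmax : ℝ) (σ : ℝ≥0) (t : Fin m → S → ℝ) (n : Fin m → S → ℂ) : Prop where
  time_law : ∀ k, HasLaw (t k) (ProbabilityTheory.cond volume (Set.Icc (-tmax) tmax)) P
  time_indep : iIndepFun t P
  noise_law : ∀ k, IsComplexGaussian (n k) (σ ^ 2) P
  noise_indep : iIndepFun n P
  time_noise_indep : IndepFun (fun x k => t k x) (fun x k => n k x) P

end ToneEstimation

namespace ToneEstimation

/-! ### Sub-Gaussian tails for weighted complex Gaussian sums. -/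

section SubGaussian

variable {S : Type*} [MeasurableSpace S] {P : Measure S}

/-! At `ω₀` the signal has modulus `m‖A‖`. It therefore suffices that, outside two events of
probability at most `δ`, the signal is at most `0.65 m‖A‖` farther than `π / tmax` from `ω₀` and the
noise is at most `0.125 m‖A‖` on all of `Ω`, because `0.65 + 0.125 < 1 - 0.125`. Both bounds are
reduced to a net of spacing `0.1 / tmax` with at most `6|Ω||T|` points;
`isMaxOn_noisyEstimate_of_net` is this deterministic reduction.

Signal: at a far net point the mean of the exponential sum is at most `m / 3`, and Hoeffding's
inequality keeps the sum below `0.55 m` (`measure_le_norm_sum_cexp_le`). Between net points it is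
Lipschitz, which costs `0.1 m`.

Noise: the Gaussian amplitudes are unbounded, so the process is instead expanded in a Taylor series
at the net point. Given the times, each coefficient is a Gaussian sum with weights of modulus at
most 1, and a union bound over all orders and net points controls them together
(`measure_exists_le_norm_noiseCoeff_le`, `norm_noiseProcess_le`). -/

lemma hasSubgaussianMGF_mono {X : S → ℝ} {c d : ℝ≥0} (h : HasSubgaussianMGF X c P)
    (hcd : c ≤ d) : HasSubgaussianMGF X d P where
  integrable_exp_mul := h.integrable_exp_mul
  mgf_le r := (h.mgf_le r).trans <| by
    have : (c : ℝ) ≤ d := by exact_mod_cast hcd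
    gcongr

lemma hasSubgaussianMGF_of_hasLaw_gaussianReal {X : S → ℝ} {v : ℝ≥0}
    (h : HasLaw X (gaussianReal 0 v) P) : HasSubgaussianMGF X v P where
  integrable_exp_mul r := by
    have h1 : Integrable (fun y => Real.exp (r * y)) (P.map X) := by
      rw [h.map_eq]
      exact integrable_exp_mul_gaussianReal r
    exact h1.comp_aemeasurable h.aemeasurable
  mgf_le r := by
    rw [mgf_gaussianReal h.map_eq]
    simp

lemma IsComplexGaussian.hasSubgaussianMGF_re_mul {Z : S → ℂ} {v : ℝ≥0}
    (h : IsComplexGaussian Z v P) {b : ℂ} (hb : ‖b‖ ≤ 1) :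
    HasSubgaussianMGF (fun x => (Z x * b).re) (v / 2) P := by
  have hre := (hasSubgaussianMGF_of_hasLaw_gaussianReal h.law_re).const_mul b.re
  have him := (hasSubgaussianMGF_of_hasLaw_gaussianReal h.law_im).const_mul (-b.im)
  have hind : IndepFun (fun x => b.re * (Z x).re) (fun x => -b.im * (Z x).im) P :=
    h.indep.comp (φ := fun r => b.re * r) (ψ := fun r => -b.im * r) (by fun_prop) (by fun_prop)
  have hsum := hre.add_of_indepFun him hind
  have heq : (fun x => (Z x * b).re) = fun x => b.re * (Z x).re + -b.im * (Z x).im := by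
    ext x
    rw [Complex.mul_re]
    ring
  rw [heq]
  refine hasSubgaussianMGF_mono hsum ?_
  have hb2 : b.re ^ 2 + b.im ^ 2 ≤ 1 := by
    have h1 : ‖b‖ ^ 2 ≤ 1 := pow_le_one₀ (norm_nonneg b) hb
    rw [Complex.sq_norm, Complex.normSq_apply] at h1
    nlinarith
  rw [← NNReal.coe_le_coe]
  change b.re ^ 2 * ((v / 2 : ℝ≥0) : ℝ) + (-b.im) ^ 2 * ((v / 2 : ℝ≥0) : ℝ) ≤ ((v / 2 : ℝ≥0) : ℝ)
  nlinarith [(v / 2).coe_nonneg]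

lemma exists_half_le_re_mul_of_le_norm {z : ℂ} {r : ℝ} (h : r ≤ ‖z‖) :
    ∃ w ∈ ({1, -1, Complex.I, -Complex.I} : Finset ℂ), r / 2 ≤ (z * w).re := by
  have hz := Complex.norm_le_abs_re_add_abs_im z
  by_contra! hc
  have h1 := hc 1 (by simp)
  have h2 := hc (-1) (by simp)
  have h3 := hc Complex.I (by simp)
  have h4 := hc (-Complex.I) (by simp)
  simp at h1 h2 h3 h4
  have h5 : |z.re| < r / 2 := abs_lt.2 ⟨by linarith, by linarith⟩
  have h6 : |z.im| < r / 2 := abs_lt.2 ⟨by linarith, by linarith⟩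
  linarith

/-- Allowing any `s ≥ v` covers the noiseless case: with `v = 0` itself in the denominator, the
exponent would be a division by zero and the bound trivial. -/
lemma measure_le_re_sum_mul_le [IsProbabilityMeasure P] {m : ℕ} {n : Fin m → S → ℂ} {v s : ℝ≥0}
    (hlaw : ∀ k, IsComplexGaussian (n k) v P) (hind : iIndepFun n P) (hvs : v ≤ s)
    {b : Fin m → ℂ} (hb : ∀ k, ‖b k‖ ≤ 1) {r : ℝ} (hr : 0 ≤ r) :
    P {x | r ≤ (∑ k, n k x * b k).re} ≤ ENNReal.ofReal (Real.exp (-r ^ 2 / (m * s))) := by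
  have hind' : iIndepFun (fun k x => (n k x * b k).re) P :=
    hind.comp (fun k z => (z * b k).re) (fun k => by fun_prop)
  have hsub : HasSubgaussianMGF (fun x => ∑ k, (n k x * b k).re) (∑ _k : Fin m, s / 2) P :=
    HasSubgaussianMGF.sum_of_iIndepFun hind' fun k _ =>
      hasSubgaussianMGF_mono ((hlaw k).hasSubgaussianMGF_re_mul (hb k)) (by gcongr)
  have h := hsub.measure_ge_le hr
  have hset : {x | r ≤ (∑ k, n k x * b k).re} = {x | r ≤ ∑ k, (n k x * b k).re} := by
    simp [Complex.re_sum]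
  rw [hset, ← ofReal_measureReal]
  refine ENNReal.ofReal_le_ofReal (h.trans_eq ?_)
  congr 2
  simp
  ring

lemma measure_le_norm_sum_mul_le [IsProbabilityMeasure P] {m : ℕ} {n : Fin m → S → ℂ} {v s : ℝ≥0}
    (hlaw : ∀ k, IsComplexGaussian (n k) v P) (hind : iIndepFun n P) (hvs : v ≤ s)
    {b : Fin m → ℂ} (hb : ∀ k, ‖b k‖ ≤ 1) {r : ℝ} (hr : 0 ≤ r) :
    P {x | r ≤ ‖∑ k, n k x * b k‖} ≤
      ENNReal.ofReal (4 * Real.exp (-(r / 2) ^ 2 / (m * s))) := by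
  set W : Finset ℂ := {1, -1, Complex.I, -Complex.I} with hW
  have hsub : {x | r ≤ ‖∑ k, n k x * b k‖} ⊆
      ⋃ w ∈ W, {x | r / 2 ≤ (∑ k, n k x * (b k * w)).re} := by
    intro x hx
    obtain ⟨w, hw, h⟩ := exists_half_le_re_mul_of_le_norm hx
    simp only [Set.mem_iUnion]
    refine ⟨w, hw, ?_⟩
    simpa only [Set.mem_ofPred_eq, Finset.sum_mul, mul_assoc] using h
  have hcard : W.card ≤ 4 := Finset.card_le_four
  calc P {x | r ≤ ‖∑ k, n k x * b k‖}
      ≤ ∑ w ∈ W, P {x | r / 2 ≤ (∑ k, n k x * (b k * w)).re} :=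
        (measure_mono hsub).trans (measure_biUnion_finset_le _ _)
    _ ≤ ∑ _w ∈ W, ENNReal.ofReal (Real.exp (-(r / 2) ^ 2 / (m * s))) := by
        refine Finset.sum_le_sum fun w hw => ?_
        refine measure_le_re_sum_mul_le hlaw hind hvs (fun k => ?_) (by positivity)
        have hw1 : ‖w‖ = 1 := by
          simp only [hW, Finset.mem_insert, Finset.mem_singleton] at hw
          rcases hw with rfl | rfl | rfl | rfl <;> simp
        simpa [hw1] using hb k
    _ ≤ ENNReal.ofReal (4 * Real.exp (-(r / 2) ^ 2 / (m * s))) := by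
        rw [Finset.sum_const, nsmul_eq_mul, ENNReal.ofReal_mul (by norm_num)]
        gcongr
        simpa using (Nat.cast_le (α := ℝ≥0∞)).2 hcard

/-- Conditioning by Fubini: the times are frozen at a typical value, so that the noise sums have
deterministic weights. -/
lemma measure_prodMk_mem_le_of_indepFun [IsProbabilityMeasure P] {α β : Type*} [MeasurableSpace α]
    [MeasurableSpace β] {X : S → α} {Y : S → β} (hX : AEMeasurable X P) (hY : AEMeasurable Y P)
    (hXY : IndepFun X Y P) {E : Set (α × β)} (hE : MeasurableSet E) {c : ℝ≥0∞}
    (h : ∀ᵐ x ∂P, P {y | (X x, Y y) ∈ E} ≤ c) :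
    P {x | (X x, Y x) ∈ E} ≤ c := by
  have := Measure.isProbabilityMeasure_map hX
  have := Measure.isProbabilityMeasure_map hY
  have h1 : P {x | (X x, Y x) ∈ E} = P.map (fun x => (X x, Y x)) E :=
    (Measure.map_apply_of_aemeasurable (hX.prodMk hY) hE).symm
  have h2 : Measurable fun a => P.map Y (Prod.mk a ⁻¹' E) := measurable_measure_prodMk_left hE
  rw [h1, (indepFun_iff_map_prod_eq_prod_map_map hX hY).1 hXY, Measure.prod_apply hE,
    lintegral_map' h2.aemeasurable hX]
  calc ∫⁻ x, P.map Y (Prod.mk (X x) ⁻¹' E) ∂P ≤ ∫⁻ _x, c ∂P := by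
        refine lintegral_mono_ae ?_
        filter_upwards [h] with x hx
        rwa [Measure.map_apply_of_aemeasurable hY (measurable_prodMk_left hE)]
    _ = c := by simp

end SubGaussian

end ToneEstimation

namespace ToneEstimation

/-! ### Concentration and continuity of the exponential sum. -/

section Signal

variable {S : Type*} [MeasurableSpace S] {P : Measure S} [IsProbabilityMeasure P]

lemma norm_sum_cexp_le_add {m : ℕ} {tmax r ν ν' : ℝ} {t : Fin m → ℝ}
    (ht : ∀ k, |t k| ≤ tmax) (hν : |ν - ν'| * tmax ≤ r) :
    ‖∑ k, Complex.exp (Complex.I * (ν * t k : ℝ))‖ ≤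
      ‖∑ k, Complex.exp (Complex.I * (ν' * t k : ℝ))‖ + m * r := by
  have hdiff (k : Fin m) : ‖Complex.exp (Complex.I * (ν * t k : ℝ)) -
      Complex.exp (Complex.I * (ν' * t k : ℝ))‖ ≤ r := by
    have h : Complex.exp (Complex.I * (ν * t k : ℝ)) - Complex.exp (Complex.I * (ν' * t k : ℝ)) =
        Complex.exp ((ν' * t k : ℝ) * Complex.I) *
          (Complex.exp (Complex.I * ((ν - ν') * t k : ℝ)) - 1) := by
      rw [mul_sub, ← Complex.exp_add, mul_one]
      push_cast
      ring_nf
    rw [h, norm_mul, Complex.norm_exp_ofReal_mul_I, one_mul]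
    refine (Real.norm_exp_I_mul_ofReal_sub_one_le).trans ?_
    rw [Real.norm_eq_abs, abs_mul]
    exact (mul_le_mul_of_nonneg_left (ht k) (abs_nonneg _)).trans hν
  have hsum : ‖∑ k, Complex.exp (Complex.I * (ν * t k : ℝ)) -
      ∑ k, Complex.exp (Complex.I * (ν' * t k : ℝ))‖ ≤ m * r := by
    rw [← Finset.sum_sub_distrib]
    refine (norm_sum_le_of_le _ fun k _ => hdiff k).trans_eq ?_
    simp
  linarith [norm_le_norm_add_norm_sub' (∑ k, Complex.exp (Complex.I * (ν * t k : ℝ)))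
    (∑ k, Complex.exp (Complex.I * (ν' * t k : ℝ)))]

lemma measure_le_abs_sum_sub_le {m : ℕ} {t : Fin m → S → ℝ} {μ : Measure ℝ}
    (hlaw : ∀ k, HasLaw (t k) μ P) (hind : iIndepFun t P) {f : ℝ → ℝ} (hf : Measurable f)
    (hf1 : ∀ y, |f y| ≤ 1) {r : ℝ} (hr : 0 ≤ r) :
    P {x | m * r ≤ |∑ k, f (t k x) - m * ∫ y, f y ∂μ|} ≤
      ENNReal.ofReal (2 * Real.exp (-r ^ 2 * m / 2)) := by
  set M := ∫ y, f y ∂μ with hM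
  have hone (k : Fin m) : HasSubgaussianMGF (fun x => f (t k x) - M) 1 P := by
    have h := hasSubgaussianMGF_of_mem_Icc (a := -1) (b := 1) (μ := P)
      (hf.comp_aemeasurable (hlaw k).aemeasurable)
      (.of_forall fun x => abs_le.1 (hf1 (t k x)))
    have hint : ∫ x, f (t k x) ∂P = M := (hlaw k).integral_comp hf.aestronglyMeasurable
    -- Hoeffding's lemma on an interval of length 2 gives variance proxy 1.
    have h1 : (‖(1 : ℝ) - -1‖₊ / 2) ^ 2 = 1 := by
      rw [← NNReal.coe_inj]
      norm_num
    simpa only [Function.comp_apply, hint, h1] using h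
  have hind' : iIndepFun (fun k x => f (t k x) - M) P :=
    hind.comp (fun _ y => f y - M) fun _ => by fun_prop
  have hsum : HasSubgaussianMGF (fun x => ∑ k, (f (t k x) - M)) (∑ _k : Fin m, 1) P :=
    HasSubgaussianMGF.sum_of_iIndepFun hind' fun k _ => hone k
  have hexp : Real.exp (-(m * r) ^ 2 / (2 * (∑ _k : Fin m, (1 : ℝ≥0) : ℝ≥0))) =
      Real.exp (-r ^ 2 * m / 2) := by
    congr 1
    rcases eq_or_ne (m : ℝ) 0 with hm | hm
    · simp [hm]
    · simp
      field_simp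
  have h1 := hsum.measure_ge_le (ε := m * r) (by positivity)
  have h2 := hsum.neg.measure_ge_le (ε := m * r) (by positivity)
  rw [hexp] at h1 h2
  have hsub : {x | m * r ≤ |∑ k, f (t k x) - m * M|} ⊆
      {x | m * r ≤ ∑ k, (f (t k x) - M)} ∪
        {x | m * r ≤ (-fun x => ∑ k, (f (t k x) - M)) x} := by
    intro x hx
    simpa [le_abs] using hx
  refine (measure_mono hsub).trans ((measure_union_le _ _).trans ?_)
  rw [two_mul, ENNReal.ofReal_add (by positivity) (by positivity), ← ofReal_measureReal,
    ← ofReal_measureReal]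
  gcongr

lemma integral_cond_Icc {tmax : ℝ} (ht : 0 < tmax) (f : ℝ → ℝ) :
    ∫ y, f y ∂(ProbabilityTheory.cond volume (Set.Icc (-tmax) tmax)) =
      (2 * tmax)⁻¹ * ∫ y in (-tmax)..tmax, f y := by
  rw [ProbabilityTheory.cond, integral_smul_measure, Real.volume_Icc,
    intervalIntegral.integral_of_le (by linarith), integral_Icc_eq_integral_Ioc]
  rw [← ENNReal.ofReal_inv_of_pos (by linarith), ENNReal.toReal_ofReal (by
    rw [inv_nonneg]; linarith), smul_eq_mul]
  ring_nf

/-- The mean is `sin (ν tmax) / (ν tmax)`, a sinc that decays like the reciprocal of `|ν| tmax`. -/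
lemma abs_integral_cos_cond_Icc_le {tmax ν : ℝ} (ht : 0 < tmax) (hν : 3 ≤ |ν| * tmax) :
    |∫ y, Real.cos (ν * y) ∂(ProbabilityTheory.cond volume (Set.Icc (-tmax) tmax))| ≤ 1 / 3 := by
  have hν0 : ν ≠ 0 := by
    rintro rfl
    norm_num at hν
  rw [integral_cond_Icc ht, intervalIntegral.integral_comp_mul_left _ hν0, integral_cos]
  have h : |Real.sin (ν * tmax) - Real.sin (ν * -tmax)| ≤ 2 := by
    rw [abs_le]
    constructor <;> linarith [Real.sin_le_one (ν * tmax), Real.sin_le_one (ν * -tmax),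
      Real.neg_one_le_sin (ν * tmax), Real.neg_one_le_sin (ν * -tmax)]
  rw [smul_eq_mul, abs_mul, abs_mul, abs_inv, abs_inv, abs_of_pos (by linarith : 0 < 2 * tmax)]
  have hν1 : 0 < |ν| := abs_pos.2 hν0
  calc _ ≤ (2 * tmax)⁻¹ * (|ν|⁻¹ * 2) := by gcongr
    _ = 1 / (|ν| * tmax) := by field_simp
    _ ≤ 1 / 3 := one_div_le_one_div_of_le (by norm_num) hν

lemma integral_sin_cond_Icc {tmax : ℝ} (ht : 0 < tmax) (ν : ℝ) :
    ∫ y, Real.sin (ν * y) ∂(ProbabilityTheory.cond volume (Set.Icc (-tmax) tmax)) = 0 := by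
  rcases eq_or_ne ν 0 with rfl | hν0
  · simp
  rw [integral_cond_Icc ht, intervalIntegral.integral_comp_mul_left _ hν0, integral_sin]
  simp

lemma norm_sum_cexp_le {m : ℕ} (ν : ℝ) (t : Fin m → ℝ) :
    ‖∑ k, Complex.exp (Complex.I * (ν * t k : ℝ))‖ ≤
      |∑ k, Real.cos (ν * t k)| + |∑ k, Real.sin (ν * t k)| := by
  refine (Complex.norm_le_abs_re_add_abs_im _).trans_eq ?_
  congr 2
  · rw [Complex.re_sum]
    exact Finset.sum_congr rfl fun k _ => by rw [mul_comm, Complex.exp_ofReal_mul_I_re]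
  · rw [Complex.im_sum]
    exact Finset.sum_congr rfl fun k _ => by rw [mul_comm, Complex.exp_ofReal_mul_I_im]

lemma measure_le_norm_sum_cexp_le {m : ℕ} {tmax ν : ℝ} {t : Fin m → S → ℝ} (ht : 0 < tmax)
    (hlaw : ∀ k, HasLaw (t k) (ProbabilityTheory.cond volume (Set.Icc (-tmax) tmax)) P)
    (hind : iIndepFun t P) (hν : 3 ≤ |ν| * tmax) :
    P {x | m * 0.55 ≤ ‖∑ k, Complex.exp (Complex.I * (ν * t k x : ℝ))‖} ≤
      ENNReal.ofReal (4 * Real.exp (-m / 200)) := by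
  have hc := measure_le_abs_sum_sub_le hlaw hind (f := fun y => Real.cos (ν * y)) (by fun_prop)
    (fun y => Real.abs_cos_le_one _) (r := 0.1) (by norm_num)
  have hs := measure_le_abs_sum_sub_le hlaw hind (f := fun y => Real.sin (ν * y)) (by fun_prop)
    (fun y => Real.abs_sin_le_one _) (r := 0.1) (by norm_num)
  have hM := abs_integral_cos_cond_Icc_le ht hν
  rw [integral_sin_cond_Icc ht] at hs
  set M := ∫ y, Real.cos (ν * y) ∂(ProbabilityTheory.cond volume (Set.Icc (-tmax) tmax))
  have hexp : ENNReal.ofReal (4 * Real.exp (-m / 200)) =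
      ENNReal.ofReal (2 * Real.exp (-0.1 ^ 2 * m / 2)) +
        ENNReal.ofReal (2 * Real.exp (-0.1 ^ 2 * m / 2)) := by
    rw [← ENNReal.ofReal_add (by positivity) (by positivity), ← two_mul, ← mul_assoc]
    congr 2
    · norm_num
    · congr 1
      ring
  rw [hexp]
  refine le_trans ?_ (add_le_add hc hs)
  refine le_trans (measure_mono fun x hx => ?_) (measure_union_le _ _)
  by_contra hcon
  simp only [Set.mem_union, Set.mem_ofPred_eq, not_or, not_le, mul_zero, sub_zero] at hcon hx
  obtain ⟨h1, h2⟩ := hcon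
  have h3 := norm_sum_cexp_le ν fun k => t k x
  have h4 : |∑ k, Real.cos (ν * t k x)| ≤ |∑ k, Real.cos (ν * t k x) - m * M| + |m * M| := by
    simpa using abs_add_le (∑ k, Real.cos (ν * t k x) - m * M) (m * M)
  rw [abs_mul, Nat.abs_cast] at h4
  have h5 : m * |M| ≤ m * (1 / 3) := by gcongr
  have h6 : (0 : ℝ) ≤ m := m.cast_nonneg
  -- The budget is `1/3 + 0.1 + 0.1 < 0.55`: mean of the cosine, then the two deviations.
  linarith

end Signal

end ToneEstimation

namespace ToneEstimation

/-! ### Taylor expansion of the noise process and tails of its coefficients. -/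

section Noise

/-- The coefficient of order `p` in the expansion of the noise process around `ω`, namely
`∑ₖ n[k] (t_k / tmax) ^ p exp (-i ω t_k)`. -/
noncomputable def noiseCoeff {m : ℕ} (tmax : ℝ) (t : Fin m → ℝ) (n : Fin m → ℂ) (p : ℕ) (ω : ℝ) :
    ℂ :=
  ∑ k, n k * (((t k / tmax : ℝ) : ℂ) ^ p * Complex.exp (-((ω * t k : ℝ) * Complex.I)))

lemma noiseProcess_eq_sum {m : ℕ} (t : Fin m → ℝ) (n : Fin m → ℂ) (ω : ℝ) :
    noiseProcess t n ω = ∑ k, n k * Complex.exp (-((ω * t k : ℝ) * Complex.I)) := by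
  unfold noiseProcess innerProd testVector
  refine Finset.sum_congr rfl fun k _ => ?_
  rw [← Complex.exp_conj, map_mul, Complex.conj_I, Complex.conj_ofReal]
  ring_nf

lemma hasSum_noiseProcess {m : ℕ} {tmax : ℝ} (htmax : tmax ≠ 0) (t : Fin m → ℝ) (n : Fin m → ℂ)
    (ω ω' : ℝ) :
    HasSum (fun p : ℕ => (-((((ω - ω') * tmax : ℝ) : ℂ) * Complex.I)) ^ p / (p.factorial : ℂ) *
      noiseCoeff tmax t n p ω') (noiseProcess t n ω) := by
  rw [noiseProcess_eq_sum]
  simp only [noiseCoeff, Finset.mul_sum]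
  refine hasSum_sum fun k _ => ?_
  have hexp : HasSum (fun p : ℕ => (-((((ω - ω') * t k : ℝ) : ℂ) * Complex.I)) ^ p /
      (p.factorial : ℂ)) (Complex.exp (-((((ω - ω') * t k : ℝ) : ℂ) * Complex.I))) := by
    rw [Complex.exp_eq_exp_ℂ]
    exact NormedSpace.expSeries_div_hasSum_exp _
  have hsplit : -((((ω - ω') * t k : ℝ) : ℂ) * Complex.I) =
      -((((ω - ω') * tmax : ℝ) : ℂ) * Complex.I) * ((t k / tmax : ℝ) : ℂ) := by
    have : (tmax : ℂ) ≠ 0 := by exact_mod_cast htmax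
    push_cast
    field_simp
  have hval : n k * Complex.exp (-((ω * t k : ℝ) * Complex.I)) =
      n k * Complex.exp (-((ω' * t k : ℝ) * Complex.I)) *
        Complex.exp (-((((ω - ω') * t k : ℝ) : ℂ) * Complex.I)) := by
    rw [mul_assoc, ← Complex.exp_add]
    congr 2
    push_cast
    ring
  rw [hval]
  refine (congrArg (HasSum · _) (funext fun p => ?_)).mpr
    (hexp.mul_left (n k * Complex.exp (-((ω' * t k : ℝ) * Complex.I))))
  rw [hsplit, mul_pow]
  ring

/-- The growth `2 ^ p` allowed to the coefficients is absorbed by the step `0.1 ^ p`, leaving a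
geometric series of ratio `1/5` with sum `1.25`. -/
lemma norm_noiseProcess_le {m : ℕ} {tmax u : ℝ} (htmax : 0 < tmax) {t : Fin m → ℝ}
    {n : Fin m → ℂ} {ω ω' : ℝ} (hω : |ω - ω'| * tmax ≤ 0.1)
    (h : ∀ p, ‖noiseCoeff tmax t n p ω'‖ ≤ u * 2 ^ p) :
    ‖(noiseProcess t n ω)‖ ≤ 1.25 * u := by
  have hgeom : HasSum (fun p : ℕ => u * (1 / 5 : ℝ) ^ p) (u * (1 - 1 / 5)⁻¹) :=
    (hasSum_geometric_of_lt_one (by norm_num) (by norm_num)).mul_left u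
  rw [← (hasSum_noiseProcess htmax.ne' t n ω ω').tsum_eq]
  refine (tsum_of_norm_bounded hgeom fun p => ?_).trans_eq (by norm_num; ring)
  have hu : 0 ≤ u * 2 ^ p := (norm_nonneg _).trans (h p)
  rw [norm_mul, norm_div, norm_pow, norm_neg, norm_mul, Complex.norm_I, mul_one,
    Complex.norm_real, Real.norm_eq_abs, abs_mul, abs_of_pos htmax, Complex.norm_natCast]
  have hfac : (1 : ℝ) ≤ p.factorial := by exact_mod_cast p.factorial_pos
  calc (|ω - ω'| * tmax) ^ p / p.factorial * ‖noiseCoeff tmax t n p ω'‖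
      ≤ 0.1 ^ p / 1 * (u * 2 ^ p) := by
        gcongr
        exact h p
    _ = u * (1 / 5) ^ p := by
        rw [div_one, mul_left_comm, ← mul_pow]
        norm_num

variable {S : Type*} [MeasurableSpace S] {P : Measure S}

lemma IsComplexGaussian.aemeasurable {Z : S → ℂ} {v : ℝ≥0} (h : IsComplexGaussian Z v P) :
    AEMeasurable Z P :=
  Complex.measurable_ofReal.comp_aemeasurable h.law_re.aemeasurable |>.add
    ((Complex.measurable_ofReal.comp_aemeasurable h.law_im.aemeasurable).mul_const Complex.I)
    |>.congr (.of_forall fun x => Complex.re_add_im (Z x))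

lemma IsSamplingModel.ae_abs_time_le {m : ℕ} {tmax : ℝ} {σ : ℝ≥0} {t : Fin m → S → ℝ}
    {n : Fin m → S → ℂ} (h : IsSamplingModel P tmax σ t n) :
    ∀ᵐ x ∂P, ∀ k, |t k x| ≤ tmax := by
  refine ae_all_iff.2 fun k => ?_
  have hmem : ∀ᵐ y ∂(ProbabilityTheory.cond volume (Set.Icc (-tmax) tmax)), |y| ≤ tmax := by
    filter_upwards [ae_cond_mem (μ := (volume : Measure ℝ)) (measurableSet_Icc (a := -tmax)
      (b := tmax))] with y hy using abs_le.2 hy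
  have hmeas : Measurable fun y : ℝ => |y| ≤ tmax :=
    measurableSet_setOfPred.1 (measurableSet_le (by fun_prop) (by fun_prop))
  exact ((h.time_law k).ae_iff hmeas).2 hmem

variable [IsProbabilityMeasure P]

lemma IsSamplingModel.measure_le_norm_noiseCoeff_le {m : ℕ} {tmax : ℝ} {σ s : ℝ≥0}
    {t : Fin m → S → ℝ} {n : Fin m → S → ℂ} (h : IsSamplingModel P tmax σ t n) (hs : σ ^ 2 ≤ s)
    (htmax : 0 < tmax) (p : ℕ) (ω : ℝ) {r : ℝ} (hr : 0 ≤ r) :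
    P {x | r ≤ ‖noiseCoeff tmax (fun k => t k x) (fun k => n k x) p ω‖} ≤
      ENNReal.ofReal (4 * Real.exp (-(r / 2) ^ 2 / (m * s))) := by
  refine measure_prodMk_mem_le_of_indepFun (X := fun x k => t k x) (Y := fun x k => n k x)
    (E := {q : (Fin m → ℝ) × (Fin m → ℂ) | r ≤ ‖noiseCoeff tmax q.1 q.2 p ω‖})
    (aemeasurable_pi_lambda _ fun k => (h.time_law k).aemeasurable)
    (aemeasurable_pi_lambda _ fun k => (h.noise_law k).aemeasurable) h.time_noise_indep
    (measurableSet_le (by fun_prop) (by unfold noiseCoeff; fun_prop)) ?_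
  filter_upwards [h.ae_abs_time_le] with x hx
  refine measure_le_norm_sum_mul_le h.noise_law h.noise_indep hs (fun k => ?_) hr
  rw [norm_mul, ← neg_mul, ← Complex.ofReal_neg, Complex.norm_exp_ofReal_mul_I, mul_one, norm_pow,
    Complex.norm_real, Real.norm_eq_abs, abs_div, abs_of_pos htmax]
  exact pow_le_one₀ (by positivity) ((div_le_one htmax).2 (hx k))

/-- The thresholds grow with `p` so that the union bound over infinitely many orders converges; `hq`
makes its sum `4q / (1 - q)` at most `8q`. -/
lemma IsSamplingModel.measure_exists_le_norm_noiseCoeff_le {m : ℕ} {tmax : ℝ} {σ s : ℝ≥0}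
    {t : Fin m → S → ℝ} {n : Fin m → S → ℂ} (h : IsSamplingModel P tmax σ t n) (hs : σ ^ 2 ≤ s)
    (htmax : 0 < tmax) (ω : ℝ) {u : ℝ} (hu : 0 ≤ u)
    (hq : Real.exp (-(u / 2) ^ 2 / (m * s)) ≤ 1 / 2) :
    P {x | ∃ p, u * 2 ^ p ≤ ‖noiseCoeff tmax (fun k => t k x) (fun k => n k x) p ω‖} ≤
      ENNReal.ofReal (8 * Real.exp (-(u / 2) ^ 2 / (m * s))) := by
  set q := Real.exp (-(u / 2) ^ 2 / (m * s)) with hqdef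
  have hq0 : 0 < q := Real.exp_pos _
  have hgeom : HasSum (fun p : ℕ => 4 * q * q ^ p) (4 * q * (1 - q)⁻¹) :=
    (hasSum_geometric_of_lt_one hq0.le (by linarith)).mul_left _
  have hp (p : ℕ) : P {x | u * 2 ^ p ≤
      ‖noiseCoeff tmax (fun k => t k x) (fun k => n k x) p ω‖} ≤
        ENNReal.ofReal (4 * q * q ^ p) := by
    refine (h.measure_le_norm_noiseCoeff_le hs htmax p ω (by positivity)).trans ?_
    refine ENNReal.ofReal_le_ofReal ?_
    rw [mul_assoc, ← pow_succ', hqdef, ← Real.exp_nat_mul]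
    -- The tail at order `p` is `4 q ^ (4 ^ p)`; weakening the exponent to `p + 1` makes the series
    -- geometric.
    have h4 : ((p + 1 : ℕ) : ℝ) ≤ (2 ^ p) ^ 2 := by
      have h5 : p + 1 ≤ 2 ^ p := p.lt_two_pow_self
      have h6 : 2 ^ p ≤ (2 ^ p) ^ 2 := Nat.le_self_pow two_ne_zero _
      exact_mod_cast h5.trans h6
    have h7 : -(u * 2 ^ p / 2) ^ 2 / (m * s) = (2 ^ p) ^ 2 * (-(u / 2) ^ 2 / (m * s)) := by ring
    have h8 : -(u / 2) ^ 2 / (m * s) ≤ 0 :=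
      div_nonpos_of_nonpos_of_nonneg (by nlinarith [sq_nonneg (u / 2)]) (by positivity)
    rw [h7]
    gcongr 4 * Real.exp ?_
    exact mul_le_mul_of_nonpos_right h4 h8
  rw [Set.ofPred_exists]
  calc _ ≤ ∑' p, ENNReal.ofReal (4 * q * q ^ p) :=
        (measure_iUnion_le _).trans (ENNReal.tsum_le_tsum hp)
    _ = ENNReal.ofReal (4 * q * (1 - q)⁻¹) := by
        rw [← ENNReal.ofReal_tsum_of_nonneg (fun p => by positivity) hgeom.summable,
          hgeom.tsum_eq]
    _ ≤ ENNReal.ofReal (8 * q) := by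
        refine ENNReal.ofReal_le_ofReal ?_
        rw [← div_eq_mul_inv, div_le_iff₀ (by linarith)]
        nlinarith

end Noise

end ToneEstimation

/-! ### The frequency net, the deterministic reduction and numerical estimates. -/

namespace ToneEstimation

/-- The `j`-th point of the net of spacing `1 / (10 tmax)` starting at `-ωmax`. -/
noncomputable def netPoint (tmax ωmax : ℝ) (j : ℕ) : ℝ :=
  -ωmax + j * (0.1 / tmax)

/-- The number of points of the net covering `[-ωmax, ωmax]`. -/
noncomputable def netCard (tmax ωmax : ℝ) : ℕ :=
  ⌊20 * (ωmax * tmax)⌋₊ + 1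

lemma netCard_le {tmax ωmax : ℝ} (h : 3 ≤ (2 * ωmax) * (2 * tmax)) :
    (netCard tmax ωmax : ℝ) ≤ 6 * ((2 * ωmax) * (2 * tmax)) := by
  have := Nat.floor_le (a := 20 * (ωmax * tmax)) (by linarith)
  unfold netCard
  push_cast
  linarith

lemma exists_netPoint_near {tmax ωmax ω : ℝ} (ht : 0 < tmax) (hω : ω ∈ Set.Icc (-ωmax) ωmax) :
    ∃ j ∈ Finset.range (netCard tmax ωmax), |ω - netPoint tmax ωmax j| * tmax ≤ 0.1 := by
  obtain ⟨h1, h2⟩ := hω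
  have h0 : 0 ≤ 10 * ((ω + ωmax) * tmax) := by
    have : 0 ≤ (ω + ωmax) * tmax := mul_nonneg (by linarith) ht.le
    linarith
  refine ⟨⌊10 * ((ω + ωmax) * tmax)⌋₊, ?_, ?_⟩
  · rw [Finset.mem_range, netCard, Nat.lt_succ_iff]
    exact Nat.floor_le_floor (by nlinarith)
  · have h3 := Nat.floor_le h0
    have h4 := Nat.lt_floor_add_one (10 * ((ω + ωmax) * tmax))
    set j := ⌊10 * ((ω + ωmax) * tmax)⌋₊
    have h5 : |ω - netPoint tmax ωmax j| * tmax = |(ω + ωmax) * tmax - j * 0.1| := by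
      rw [← abs_of_pos ht, ← abs_mul, abs_of_pos ht, netPoint]
      congr 1
      field_simp
      ring
    rw [h5, abs_le]
    constructor <;> linarith

lemma signalProcess_eq {m : ℕ} (A : ℂ) (ω₀ : ℝ) (t : Fin m → ℝ) (ω : ℝ) :
    signalProcess A ω₀ t ω = A * ∑ k, Complex.exp (Complex.I * ((ω₀ - ω) * t k : ℝ)) := by
  unfold signalProcess innerProd testVector observations
  rw [Finset.mul_sum]
  refine Finset.sum_congr rfl fun k _ => ?_
  rw [← Complex.exp_conj, map_mul, Complex.conj_I, Complex.conj_ofReal, mul_assoc,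
    ← Complex.exp_add]
  congr 2
  push_cast
  ring

lemma continuous_noisyEstimate {m : ℕ} (tmax : ℝ) (A : ℂ) (ω₀ : ℝ) (t : Fin m → ℝ)
    (n : Fin m → ℂ) : Continuous (noisyEstimate tmax A ω₀ t n) := by
  unfold noisyEstimate signalProcess noiseProcess innerProd testVector
  fun_prop

lemma isMaxOn_noisyEstimate_of_net {m : ℕ} (hm : 0 < m) {tmax ωmax ω₀ : ℝ} {A : ℂ}
    {t : Fin m → ℝ} {n : Fin m → ℂ} (htmax : 0 < tmax) (hA : A ≠ 0)
    (hω₀ : ω₀ ∈ Set.Icc (-ωmax) ωmax) (ht : ∀ k, |t k| ≤ tmax)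
    (hsignal : ∀ j ∈ Finset.range (netCard tmax ωmax), 3 ≤ |ω₀ - netPoint tmax ωmax j| * tmax →
      ‖∑ k, Complex.exp (Complex.I * ((ω₀ - netPoint tmax ωmax j) * t k : ℝ))‖ < m * 0.55)
    (hnoise : ∀ j ∈ Finset.range (netCard tmax ωmax), ∀ p,
      ‖noiseCoeff tmax t n p (netPoint tmax ωmax j)‖ < 0.1 * (m * ‖A‖) * 2 ^ p) :
    (∃ ω ∈ Set.Icc (-ωmax) ωmax,
      IsMaxOn (fun ω' => ‖noisyEstimate tmax A ω₀ t n ω'‖) (Set.Icc (-ωmax) ωmax) ω) ∧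
    ∀ ω ∈ Set.Icc (-ωmax) ωmax,
      IsMaxOn (fun ω' => ‖noisyEstimate tmax A ω₀ t n ω'‖) (Set.Icc (-ωmax) ωmax) ω →
      ω ∈ Set.Icc (ω₀ - 2 * Real.pi / (2 * tmax)) (ω₀ + 2 * Real.pi / (2 * tmax)) := by
  refine ⟨isCompact_Icc.exists_isMaxOn ⟨ω₀, hω₀⟩
    (continuous_noisyEstimate tmax A ω₀ t n).norm.continuousOn, fun ω hω hmax => ?_⟩
  have hm' : (0 : ℝ) < m := by exact_mod_cast hm
  have hA' : 0 < ‖A‖ := norm_pos_iff.2 hA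
  have hN (ω' : ℝ) (hω' : ω' ∈ Set.Icc (-ωmax) ωmax) :
      ‖(noiseProcess t n ω')‖ ≤ 1.25 * (0.1 * (m * ‖A‖)) := by
    obtain ⟨j, hj, hjd⟩ := exists_netPoint_near htmax hω'
    exact norm_noiseProcess_le htmax hjd fun p => (hnoise j hj p).le
  by_contra hcon
  have hfar : Real.pi < |ω₀ - ω| * tmax := by
    by_contra! h
    refine hcon ?_
    rw [← le_div_iff₀ htmax, abs_le] at h
    rw [mul_div_mul_left _ _ two_ne_zero]
    exact ⟨by linarith, by linarith⟩
  obtain ⟨j, hj, hjd⟩ := exists_netPoint_near htmax hω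
  set ν := netPoint tmax ωmax j
  have htri : |ω₀ - ω| ≤ |ω₀ - ν| + |ω - ν| := by
    rw [abs_sub_comm ω ν]
    exact abs_sub_le _ _ _
  -- Moving to the net point costs `0.1`, and `π - 0.1 > 3`.
  have hfar' : 3 ≤ |ω₀ - ν| * tmax := by
    have h1 := mul_le_mul_of_nonneg_right htri htmax.le
    have h2 := Real.pi_gt_d2
    linarith
  have hX : ‖(signalProcess A ω₀ t ω)‖ ≤ ‖A‖ * (m * 0.55 + m * 0.1) := by
    rw [signalProcess_eq, norm_mul]
    gcongr
    refine (norm_sum_cexp_le_add (ν' := ω₀ - ν) ht (r := 0.1) ?_).trans ?_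
    · rwa [sub_sub_sub_cancel_left, abs_sub_comm]
    · gcongr
      exact (hsignal j hj hfar').le
  have hX₀ : ‖(signalProcess A ω₀ t ω₀)‖ = ‖A‖ * m := by
    rw [signalProcess_eq]
    simp
  have hscale : 0 < ‖((2 * Real.pi * (2 * tmax) / m : ℝ) : ℂ)‖ := by
    rw [Complex.norm_real, norm_pos_iff]
    positivity
  have hle : ‖noisyEstimate tmax A ω₀ t n ω₀‖ ≤ ‖noisyEstimate tmax A ω₀ t n ω‖ := hmax hω₀
  simp only [noisyEstimate, norm_mul] at hle
  have hle' := le_of_mul_le_mul_left hle hscale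
  have h1 := norm_add_le (signalProcess A ω₀ t ω) (noiseProcess t n ω)
  have h2 := norm_sub_le_norm_add (signalProcess A ω₀ t ω₀) (noiseProcess t n ω₀)
  have h3 := hN ω hω
  have h4 := hN ω₀ hω₀
  have h5 : 0 < m * ‖A‖ := by positivity
  linarith

/-- Subadditivity replaces passing to complements, so `G` need not be measurable. -/
lemma ofReal_one_sub_two_mul_le_measure {S : Type*} [MeasurableSpace S] {P : Measure S}
    [IsProbabilityMeasure P] {δ : ℝ} (hδ : 0 ≤ δ) {G B₁ B₂ : Set S} {p : S → Prop}
    (h₁ : P B₁ ≤ ENNReal.ofReal δ) (h₂ : P B₂ ≤ ENNReal.ofReal δ) (hp : ∀ᵐ x ∂P, p x)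
    (h : ∀ x, x ∉ B₁ → x ∉ B₂ → p x → x ∈ G) : ENNReal.ofReal (1 - 2 * δ) ≤ P G := by
  have hle : P Set.univ ≤ P (G ∪ (B₁ ∪ B₂)) := by
    refine measure_mono_ae ?_
    filter_upwards [hp] with x hx _
    change x ∈ G ∪ (B₁ ∪ B₂)
    by_contra hcon
    simp only [Set.mem_union, not_or] at hcon
    exact hcon.1 (h x hcon.2.1 hcon.2.2 hx)
  rw [ENNReal.ofReal_sub _ (by positivity), ENNReal.ofReal_one, tsub_le_iff_right]
  calc (1 : ℝ≥0∞) = P Set.univ := measure_univ.symm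
    _ ≤ P G + P (B₁ ∪ B₂) := hle.trans (measure_union_le _ _)
    _ ≤ P G + (P B₁ + P B₂) := by
      gcongr
      exact measure_union_le _ _
    _ ≤ P G + (ENNReal.ofReal δ + ENNReal.ofReal δ) := by gcongr
    _ = P G + ENNReal.ofReal (2 * δ) := by rw [← ENNReal.ofReal_add hδ hδ, two_mul]

lemma six_mul_four_mul_exp_le {x δ r : ℝ} (hx : 3 ≤ x) (hδ : 0 < δ) (hδ' : δ ≤ 1 / 2)
    (hr : 400 * Real.log (12 * x / δ) ≤ r) :
    6 * x * (4 * Real.exp (-r / 200)) ≤ δ := by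
  have hpos : 0 < 12 * x / δ := by positivity
  have hexp : Real.exp (-r / 200) ≤ (12 * x / δ)⁻¹ ^ 2 := by
    rw [← Real.exp_log hpos]
    rw [← Real.exp_neg, ← Real.exp_nat_mul]
    gcongr
    push_cast
    linarith
  calc 6 * x * (4 * Real.exp (-r / 200)) ≤ 6 * x * (4 * (12 * x / δ)⁻¹ ^ 2) := by gcongr
    _ = δ * (δ / (6 * x)) := by
      field_simp
      norm_num
    _ ≤ δ * 1 := by
      gcongr
      rw [div_le_one (by positivity)]
      linarith
    _ = δ := mul_one δ

lemma exp_neg_five_mul_le {x δ l : ℝ} (hx : 3 ≤ x) (hδ : 0 < δ) (hδ' : δ ≤ 1 / 2)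
    (hlx : Real.log x ≤ l) (hlδ : Real.log (2 / δ) ≤ l) :
    Real.exp (-(5 * l)) ≤ 1 / 2 ∧ 6 * x * (8 * Real.exp (-(5 * l))) ≤ δ := by
  have hx0 : 0 < x := by linarith
  have h1 : Real.exp (-l) ≤ x⁻¹ := by
    rw [← Real.exp_log hx0, ← Real.exp_neg]
    gcongr
  have h2 : Real.exp (-l) ≤ δ / 2 := by
    rw [← inv_div, ← Real.exp_log (by positivity : 0 < 2 / δ), ← Real.exp_neg]
    gcongr
  have h3 : Real.exp (-l) ≤ 1 / 4 := by linarith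
  have hpos := Real.exp_pos (-l)
  have h4 : Real.exp (-(5 * l)) ≤ x⁻¹ * (δ / 2) * (1 / 4) ^ 3 := by
    -- One factor pays for the size of the net, one for `δ`, and three for the numerical constants.
    have h5 : Real.exp (-(5 * l)) = Real.exp (-l) * Real.exp (-l) * Real.exp (-l) ^ 3 := by
      rw [← Real.exp_nat_mul, ← Real.exp_add, ← Real.exp_add]
      push_cast
      ring_nf
    rw [h5]
    gcongr
  constructor
  · have h6 : x⁻¹ ≤ 1 := inv_le_one_of_one_le₀ (by linarith)
    nlinarith
  · calc 6 * x * (8 * Real.exp (-(5 * l))) ≤ 6 * x * (8 * (x⁻¹ * (δ / 2) * (1 / 4) ^ 3)) := by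
          gcongr
      _ = 3 / 8 * δ := by
          field_simp
          norm_num
      _ ≤ δ := by linarith

/-! ### Union bounds over the net. -/

section Probability

variable {S : Type*} [MeasurableSpace S] {P : Measure S} [IsProbabilityMeasure P]
  {m : ℕ} {tmax : ℝ} {σ : ℝ≥0} {t : Fin m → S → ℝ} {n : Fin m → S → ℂ}

lemma IsSamplingModel.measure_exists_netPoint_signal_le (h : IsSamplingModel P tmax σ t n)
    (htmax : 0 < tmax) (ωmax ω₀ : ℝ) :
    P {x | ∃ j ∈ Finset.range (netCard tmax ωmax), 3 ≤ |ω₀ - netPoint tmax ωmax j| * tmax ∧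
      m * 0.55 ≤ ‖∑ k, Complex.exp (Complex.I * ((ω₀ - netPoint tmax ωmax j) * t k x : ℝ))‖} ≤
      ENNReal.ofReal (netCard tmax ωmax * (4 * Real.exp (-m / 200))) := by
  have hsub : {x | ∃ j ∈ Finset.range (netCard tmax ωmax),
      3 ≤ |ω₀ - netPoint tmax ωmax j| * tmax ∧ m * 0.55 ≤
        ‖∑ k, Complex.exp (Complex.I * ((ω₀ - netPoint tmax ωmax j) * t k x : ℝ))‖} ⊆
      ⋃ j ∈ Finset.range (netCard tmax ωmax), {x | 3 ≤ |ω₀ - netPoint tmax ωmax j| * tmax ∧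
        m * 0.55 ≤
          ‖∑ k, Complex.exp (Complex.I * ((ω₀ - netPoint tmax ωmax j) * t k x : ℝ))‖} := by
    rintro x ⟨j, hj, hx⟩
    simp only [Set.mem_iUnion]
    exact ⟨j, hj, hx⟩
  refine (measure_mono hsub).trans ((measure_biUnion_finset_le _ _).trans ?_)
  refine (Finset.sum_le_card_nsmul _ _ (ENNReal.ofReal (4 * Real.exp (-m / 200)))
    fun j _ => ?_).trans_eq ?_
  · by_cases hj : 3 ≤ |ω₀ - netPoint tmax ωmax j| * tmax
    · simpa only [hj, true_and] using
        measure_le_norm_sum_cexp_le htmax h.time_law h.time_indep hj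
    · simp [hj]
  · rw [Finset.card_range, nsmul_eq_mul, ENNReal.ofReal_mul (Nat.cast_nonneg _),
      ENNReal.ofReal_natCast]

lemma IsSamplingModel.measure_exists_netPoint_noise_le {s : ℝ≥0}
    (h : IsSamplingModel P tmax σ t n) (hs : σ ^ 2 ≤ s) (htmax : 0 < tmax) (ωmax : ℝ) {u : ℝ}
    (hu : 0 ≤ u) (hq : Real.exp (-(u / 2) ^ 2 / (m * s)) ≤ 1 / 2) :
    P {x | ∃ j ∈ Finset.range (netCard tmax ωmax), ∃ p, u * 2 ^ p ≤
      ‖noiseCoeff tmax (fun k => t k x) (fun k => n k x) p (netPoint tmax ωmax j)‖} ≤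
      ENNReal.ofReal (netCard tmax ωmax * (8 * Real.exp (-(u / 2) ^ 2 / (m * s)))) := by
  have hsub : {x | ∃ j ∈ Finset.range (netCard tmax ωmax), ∃ p, u * 2 ^ p ≤
      ‖noiseCoeff tmax (fun k => t k x) (fun k => n k x) p (netPoint tmax ωmax j)‖} ⊆
      ⋃ j ∈ Finset.range (netCard tmax ωmax), {x | ∃ p, u * 2 ^ p ≤
        ‖noiseCoeff tmax (fun k => t k x) (fun k => n k x) p (netPoint tmax ωmax j)‖} := by
    rintro x ⟨j, hj, hx⟩
    simp only [Set.mem_iUnion]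
    exact ⟨j, hj, hx⟩
  refine (measure_mono hsub).trans ((measure_biUnion_finset_le _ _).trans ?_)
  refine (Finset.sum_le_card_nsmul _ _ _ fun j _ =>
    h.measure_exists_le_norm_noiseCoeff_le hs htmax (netPoint tmax ωmax j) hu hq).trans_eq ?_
  rw [Finset.card_range, nsmul_eq_mul, ENNReal.ofReal_mul (Nat.cast_nonneg _),
    ENNReal.ofReal_natCast]

end Probability

end ToneEstimation

/-! ### Choice of constants and conclusion. -/

theorem mainTheorem7 :
    ∃ C₃ C₅ : ℝ, 0 < C₃ ∧ 0 < C₅ ∧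
      ∀ (S : Type*) [MeasurableSpace S] (P : Measure S) [IsProbabilityMeasure P]
        (m : ℕ) (tmax ωmax : ℝ) (A : ℂ) (ω₀ : ℝ) (σ : ℝ≥0) (δ : ℝ)
        (t : Fin m → S → ℝ) (n : Fin m → S → ℂ),
        0 < tmax → 0 < ωmax → A ≠ 0 → ω₀ ∈ Set.Icc (-ωmax) ωmax → 0 < δ →
        ToneEstimation.IsSamplingModel P tmax σ t n →
        3 ≤ (2 * ωmax) * (2 * tmax) →
        C₃ * Real.log (1 / δ) ≤ (m : ℝ) →
        C₅ * max (Real.log (12 * ((2 * ωmax) * (2 * tmax)) / δ) / (1 - 0.218) ^ 2)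
            (max
              (√(Real.log (4 / δ) * Real.log (12 * ((2 * ωmax) * (2 * tmax)) / δ))
                / (1 - 0.218))
              (max (Real.log ((2 * ωmax) * (2 * tmax))) (Real.log (2 / δ)) / (1 - 0.218) ^ 2
                * ((σ : ℝ) ^ 2 / ‖A‖ ^ 2))) ≤ (m : ℝ) →
        ENNReal.ofReal (1 - 2 * δ) ≤
          P {x |
            (∃ ω ∈ Set.Icc (-ωmax) ωmax,
              IsMaxOn (fun ω' => ‖ToneEstimation.noisyEstimate tmax A ω₀
                (fun k => t k x) (fun k => n k x) ω'‖) (Set.Icc (-ωmax) ωmax) ω) ∧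
            ∀ ω ∈ Set.Icc (-ωmax) ωmax,
              IsMaxOn (fun ω' => ‖ToneEstimation.noisyEstimate tmax A ω₀
                (fun k => t k x) (fun k => n k x) ω'‖) (Set.Icc (-ωmax) ωmax) ω →
              ω ∈ Set.Icc (ω₀ - 2 * Real.pi / (2 * tmax)) (ω₀ + 2 * Real.pi / (2 * tmax))} := by
  refine ⟨1, 2000, one_pos, by norm_num, ?_⟩
  intro S _ P _ m tmax ωmax A ω₀ σ δ t n htmax hωmax hA hω₀ hδ hmodel hx hmδ hm
  -- For `δ ≥ 1/2` the claimed probability is not positive.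
  rcases le_or_gt (1 / 2) δ with hδ' | hδ'
  · rw [ENNReal.ofReal_of_nonpos (by linarith)]
    exact zero_le
  set x := (2 * ωmax) * (2 * tmax) with hxdef
  set l := max (Real.log x) (Real.log (2 / δ)) with hl
  have hm0 : (0 : ℝ) < m := by
    have : 0 < Real.log (1 / δ) := Real.log_pos (by rw [lt_div_iff₀ hδ]; linarith)
    linarith
  have hA' : 0 < ‖A‖ := norm_pos_iff.2 hA
  have hl0 : 0 < l := lt_max_of_lt_left (Real.log_pos (by linarith))
  have hm1 : 400 * Real.log (12 * x / δ) ≤ m := by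
    have h1 := (mul_le_mul_of_nonneg_left (le_max_left _ _) (by norm_num)).trans hm
    have h2 : 0 ≤ Real.log (12 * x / δ) :=
      Real.log_nonneg (by rw [le_div_iff₀ hδ]; linarith)
    norm_num at h1
    linarith
  have hm2 : 2000 * l * (σ : ℝ) ^ 2 ≤ m * ‖A‖ ^ 2 := by
    have h1 := (mul_le_mul_of_nonneg_left ((le_max_right _ _).trans (le_max_right _ _))
      (by norm_num)).trans hm
    have h2 : 0 ≤ l * ((σ : ℝ) ^ 2 / ‖A‖ ^ 2) := by positivity
    have h3 : 2000 * (l * ((σ : ℝ) ^ 2 / ‖A‖ ^ 2)) ≤ m := by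
      refine le_trans ?_ h1
      rw [div_mul_eq_mul_div]
      gcongr
      exact le_div_self h2 (by norm_num) (by norm_num)
    rw [← mul_div_assoc, ← mul_div_assoc, div_le_iff₀ (by positivity), ← mul_assoc] at h3
    exact h3
  -- This is the largest variance that `hm2` permits; it is positive even when `σ = 0`, and it makes
  -- the noise exponent exactly `-5l`.
  obtain ⟨s, hs⟩ : ∃ s : ℝ≥0, (s : ℝ) = m * ‖A‖ ^ 2 / (2000 * l) :=
    ⟨⟨m * ‖A‖ ^ 2 / (2000 * l), by positivity⟩, rfl⟩
  have hσs : σ ^ 2 ≤ s := by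
    rw [← NNReal.coe_le_coe, hs, le_div_iff₀ (by positivity)]
    push_cast
    linarith
  have hexp : -(0.1 * (m * ‖A‖) / 2) ^ 2 / (m * s) = -(5 * l) := by
    rw [hs]
    field_simp
    norm_num
  obtain ⟨hq, hδ₂⟩ := ToneEstimation.exp_neg_five_mul_le hx hδ hδ'.le (le_max_left _ _)
    (le_max_right _ _ : Real.log (2 / δ) ≤ l)
  have hδ₁ := ToneEstimation.six_mul_four_mul_exp_le hx hδ hδ'.le hm1
  have hcard := ToneEstimation.netCard_le hx
  have hsignal := hmodel.measure_exists_netPoint_signal_le htmax ωmax ω₀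
  have hnoise := hmodel.measure_exists_netPoint_noise_le hσs htmax ωmax
    (u := 0.1 * (m * ‖A‖)) (by positivity) (by rwa [hexp])
  have htime := hmodel.ae_abs_time_le
  rw [hexp] at hnoise
  replace hsignal := hsignal.trans (ENNReal.ofReal_le_ofReal
    ((mul_le_mul_of_nonneg_right hcard (by positivity)).trans hδ₁))
  replace hnoise := hnoise.trans (ENNReal.ofReal_le_ofReal
    ((mul_le_mul_of_nonneg_right hcard (by positivity)).trans hδ₂))
  refine ToneEstimation.ofReal_one_sub_two_mul_le_measure hδ.le hsignal hnoise htime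
    fun y h1 h2 h3 => ?_
  refine ToneEstimation.isMaxOn_noisyEstimate_of_net (by exact_mod_cast hm0) htmax hA hω₀
    h3 (fun j hj hfar => ?_) (fun j hj p => ?_)
  · exact lt_of_not_ge fun hle => h1 ⟨j, hj, hfar, hle⟩
  · exact lt_of_not_ge fun hle => h2 ⟨j, hj, p, hle⟩
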